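/- Let $(\Gamma,S)$ be a Coxeter system with $S$ finite. A permutation $\mathbb{C}\Gamma$-module $U$ is a complex vector space with a finite basis $\Omega$ (the vertices) on which $\Gamma$ acts by permutations, extended linearly to $U$; it is transitive if $\Omega$ is a single (non-empty) orbit. It is orientable if some vertex is fixed by no word in an odd number of the generators $S$. The subgroups corresponding to $U$ are the vertex stabilizers (for transitive $U$ they form one conjugacy class), and $U$ is torsion free if none of them meets the conjugacy class of a non-trivial element of finite order of $\Gamma$. 1. Let $U_1,U_2$ be permutation modules with bases $\Omega_1,\Omega_2$, where $\Omega_2\neq\emptyset$, and let $U_1$ be orientable. Then the full tensor product $U_1\otimes U_2$, with basis $\Omega_1\times\Omega_2$ and the diagonal action, is orientable, and so is the transitive module spanned by some $\Gamma$-orbit in $\Omega_1\times\Omega_2$. If $U_1$ is moreover transitive, then the module spanned by any $\Gamma$-orbit in $\Omega_1\times\Omega_2$ is orientable. 2. Let $(\Gamma,S)$ be hyperbolic of dimension $n$: there is a convex polytope $P=\bigcap_{s\in S}H_s^-$ with non-empty interior in $\mathbb{H}^n$, where $H_s^-$ is a closed half-space bounded by a hyperplane $H_s$, such that sending $s\in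 S$ to the reflection in $H_s$ induces an isomorphism of $\Gamma$ onto the group generated by these reflections, and this group is discrete, i.e. acts properly on $\mathbb{H}^n$. Let $U$ be a transitive, torsion free permutation $\mathbb{C}\Gamma$-module and let $\Pi$ be any of its corresponding subgroups. Then $\mathbb{H}^n/\Pi$ is a manifold (Hausdorff, second countable, with a smooth structure for which $\mathbb{H}^n\to\mathbb{H}^n/\Pi$ is a local diffeomorphism), and the following are equivalent: (a) the manifold $\mathbb{H}^n/\Pi$ is orientable (for any such smooth structure); (b) $U$ is orientable; (c) every element of $\Pi$ can be written as a word in an even number of the generators $S$. -/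

import Mathlib

open scoped Manifold ContDiff TensorProduct

noncomputable section

/-! ## Permutation modules -/

/-- A permutation `ℂΓ`-module: a complex vector space `U` with a linear action of `Γ` and a basis
`Ω` (whose elements are the vertices) that is permuted by `Γ`. -/
structure PermutationModule (Γ Ω U : Type*) [Group Γ] [AddCommGroup U] [Module ℂ U] where
  rep : Representation ℂ Γ U
  basis : Module.Basis Ω ℂ U
  permutes : ∀ (γ : Γ) (v : Ω), ∃ v' : Ω, rep γ (basis v) = basis v'

namespace PermutationModule

section

variable {Γ Ω U : Type*} [Group Γ] [AddCommGroup U] [Module ℂ U]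

/-- `γ` fixes the vertex `v`. -/
def Fixes (V : PermutationModule Γ Ω U) (γ : Γ) (v : Ω) : Prop :=
  V.rep γ (V.basis v) = V.basis v

/-- The orbit of the vertex `v`. -/
def orbit (V : PermutationModule Γ Ω U) (v : Ω) : Set Ω :=
  {v' | ∃ γ : Γ, V.rep γ (V.basis v) = V.basis v'}

/-- The action on the (non-empty) basis is transitive. -/
def IsTransitive (V : PermutationModule Γ Ω U) : Prop :=
  Nonempty Ω ∧ ∀ v v' : Ω, v' ∈ V.orbit v

/-- The stabilizer of a vertex. -/
def stabilizer (V : PermutationModule Γ Ω U) (v : Ω) : Subgroup Γ where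
  carrier := {γ | V.Fixes γ v}
  one_mem' := by simp [Fixes]
  mul_mem' {a b} ha hb := by
    simp only [Fixes, Set.mem_ofPred_eq] at *
    simp [map_mul, ha, hb]
  inv_mem' {a} ha := by
    simp only [Fixes, Set.mem_ofPred_eq] at *
    conv_lhs => rw [← ha]
    simp

/-- The subgroups corresponding to the module, that is, the stabilizers of its vertices. If the
module is transitive, they form exactly one conjugacy class of subgroups. -/
def correspondingSubgroups (V : PermutationModule Γ Ω U) : Set (Subgroup Γ) :=
  Set.range V.stabilizer

/-- The module avoids a set `C` (a conjugacy class) of elements of `Γ`: none of the corresponding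
subgroups meets it. -/
def Avoids (V : PermutationModule Γ Ω U) (C : Set Γ) : Prop :=
  ∀ P ∈ V.correspondingSubgroups, Disjoint (P : Set Γ) C

/-- The module avoids the conjugacy classes of all (non-trivial) torsion elements. -/
def IsTorsionFree (V : PermutationModule Γ Ω U) : Prop :=
  ∀ γ : Γ, γ ≠ 1 → IsOfFinOrder γ → V.Avoids (conjugatesOf γ)

/-- Some vertex is not fixed by any word in an odd number of the Coxeter generators. -/
def IsOrientable {B : Type*} {M : CoxeterMatrix B} (V : PermutationModule Γ Ω U)
    (cs : CoxeterSystem M Γ) : Prop :=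
  ∃ v : Ω, ∀ w : List B, Odd w.length → ¬ V.Fixes (cs.wordProd w) v

theorem span_orbit_le (V : PermutationModule Γ Ω U) (v : Ω) (γ : Γ) :
    Submodule.span ℂ (Set.range fun x : V.orbit v => V.basis x) ≤
      (Submodule.span ℂ (Set.range fun x : V.orbit v => V.basis x)).comap (V.rep γ) := by
  rw [Submodule.span_le]
  rintro _ ⟨⟨x, δ, hδ⟩, rfl⟩
  obtain ⟨y, hy⟩ := V.permutes γ x
  refine Submodule.subset_span ⟨⟨y, γ * δ, ?_⟩, hy.symm⟩
  rw [map_mul, Module.End.mul_apply, hδ, hy]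

/-- The transitive permutation module spanned by the orbit of a vertex. -/
def orbitModule (V : PermutationModule Γ Ω U) (v : Ω) :
    PermutationModule Γ (V.orbit v)
      (Submodule.span ℂ (Set.range fun x : V.orbit v => V.basis x)) where
  rep := V.rep.subrepresentation _ (V.span_orbit_le v)
  basis := Module.Basis.span (V.basis.linearIndependent.comp _ Subtype.val_injective)
  permutes γ x := by
    obtain ⟨x, δ, hδ⟩ := x
    obtain ⟨y, hy⟩ := V.permutes γ x
    refine ⟨⟨y, γ * δ, by rw [map_mul, Module.End.mul_apply, hδ, hy]⟩, Subtype.ext ?_⟩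
    simpa [Module.Basis.span_apply] using hy

end

/-- The tensor product, a permutation module with basis `Ω₁ × Ω₂` and the diagonal action. -/
def tensor {Γ Ω₁ Ω₂ U₁ U₂ : Type*} [Group Γ] [AddCommGroup U₁] [Module ℂ U₁]
    [AddCommGroup U₂] [Module ℂ U₂]
    (V₁ : PermutationModule Γ Ω₁ U₁) (V₂ : PermutationModule Γ Ω₂ U₂) :
    PermutationModule Γ (Ω₁ × Ω₂) (U₁ ⊗[ℂ] U₂) where
  rep := V₁.rep.tprod V₂.rep
  basis := V₁.basis.tensorProduct V₂.basis
  permutes γ x := by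
    obtain ⟨y₁, h₁⟩ := V₁.permutes γ x.1
    obtain ⟨y₂, h₂⟩ := V₂.permutes γ x.2
    exact ⟨(y₁, y₂), by
      simp [Representation.tprod_apply, Module.Basis.tensorProduct_apply', h₁, h₂]⟩

end PermutationModule

/-! ## Hyperbolic space -/

/-- The Lorentz form `-x₀y₀ + x₁y₁ + ⋯ + xₙyₙ`. -/
def lorentzForm {n : ℕ} (x y : Fin (n + 1) → ℝ) : ℝ :=
  -(x 0 * y 0) + ∑ i : Fin n, x i.succ * y i.succ

/-- Hyperbolic `n`-space: the upper sheet of the hyperboloid. -/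
def HyperbolicSpace (n : ℕ) : Type :=
  {x : Fin (n + 1) → ℝ // lorentzForm x x = -1 ∧ 0 < x 0}

namespace HyperbolicSpace

variable {n : ℕ}

instance : TopologicalSpace (HyperbolicSpace n) :=
  inferInstanceAs (TopologicalSpace {x : Fin (n + 1) → ℝ // lorentzForm x x = -1 ∧ 0 < x 0})

/-- The point `(√(1 + |y|²), y)` of the hyperboloid above `y`. -/
def ofEuclidean (y : EuclideanSpace ℝ (Fin n)) : HyperbolicSpace n :=
  ⟨Fin.cons √(1 + ∑ i, y i ^ 2) fun i => y i, by
    have h : 0 < 1 + ∑ i, y i ^ 2 :=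
      add_pos_of_pos_of_nonneg one_pos (Finset.sum_nonneg fun i _ => sq_nonneg _)
    refine ⟨?_, by simpa using h⟩
    simp only [lorentzForm, Fin.cons_zero, Fin.cons_succ, Real.mul_self_sqrt h.le, ← pow_two]
    ring⟩

/-- The projection `(x₀, x₁, …, xₙ) ↦ (x₁, …, xₙ)`, a homeomorphism onto `ℝⁿ`. -/
def toEuclidean : HyperbolicSpace n ≃ₜ EuclideanSpace ℝ (Fin n) where
  toFun x := WithLp.toLp 2 fun i => x.1 i.succ
  invFun := ofEuclidean
  left_inv x := by
    obtain ⟨x, hx, hx0⟩ := x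
    refine Subtype.ext (funext fun i => ?_)
    refine Fin.cases ?_ (fun i => ?_) i
    · simp only [ofEuclidean, Fin.cons_zero]
      simp only [lorentzForm, ← pow_two] at hx
      rw [show 1 + ∑ i : Fin n, x i.succ ^ 2 = x 0 ^ 2 by linarith]
      exact Real.sqrt_sq hx0.le
    · simp [ofEuclidean]
  right_inv y := by
    ext i
    simp [ofEuclidean]
  continuous_toFun := by
    refine (PiLp.continuous_toLp 2 _).comp (continuous_pi fun i => ?_)
    exact (continuous_apply i.succ).comp continuous_subtype_val
  continuous_invFun := by
    refine Continuous.subtype_mk (continuous_pi fun i => ?_) _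
    refine Fin.cases ?_ (fun i => ?_) i
    · simp only [Fin.cons_zero]
      fun_prop
    · simp only [Fin.cons_succ]
      fun_prop

/-- The standard smooth structure on hyperbolic space. -/
instance : ChartedSpace (EuclideanSpace ℝ (Fin n)) (HyperbolicSpace n) :=
  toEuclidean.toOpenPartialHomeomorph.singletonChartedSpace rfl

/-- Unit normal vectors; they parametrize the (cooriented) hyperplanes of hyperbolic space. -/
def UnitNormal (n : ℕ) : Type :=
  {e : Fin (n + 1) → ℝ // lorentzForm e e = 1}

/-- The closed half-space with outward normal `e`, bounded by the hyperplane orthogonal to `e`. -/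
def halfSpace (e : UnitNormal n) : Set (HyperbolicSpace n) :=
  {x | lorentzForm x.1 e.1 ≤ 0}

theorem reflect_mem (e : UnitNormal n) (x : HyperbolicSpace n) :
    lorentzForm (x.1 - (2 * lorentzForm x.1 e.1) • e.1) (x.1 - (2 * lorentzForm x.1 e.1) • e.1)
        = -1 ∧ 0 < (x.1 - (2 * lorentzForm x.1 e.1) • e.1) 0 := by
  obtain ⟨e, he⟩ := e
  obtain ⟨x, hx, hx0⟩ := x
  dsimp only
  have expand : ∀ (u v : Fin (n + 1) → ℝ) (c : ℝ),
      lorentzForm u (v - c • e) = lorentzForm u v - c * lorentzForm u e := by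
    intro u v c
    simp only [lorentzForm, Pi.sub_apply, Pi.smul_apply, smul_eq_mul, mul_sub,
      Finset.sum_sub_distrib, mul_add, Finset.mul_sum]
    rw [Finset.sum_congr rfl fun i _ => mul_left_comm (u (Fin.succ i)) c (e (Fin.succ i))]
    ring
  have symm : ∀ u v : Fin (n + 1) → ℝ, lorentzForm u v = lorentzForm v u := by
    intro u v
    simp only [lorentzForm, mul_comm]
  set c := 2 * lorentzForm x e with hc
  set y := x - c • e with hy
  have hxy : lorentzForm x y = -1 - 2 * lorentzForm x e ^ 2 := by
    rw [hy, expand, hx, hc]; ring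
  have hey : lorentzForm y e = - lorentzForm x e := by
    rw [symm y, hy, expand, he, symm e, hc]; ring
  have hyy : lorentzForm y y = -1 := by
    conv_lhs => rw [hy]
    rw [expand, ← hy, symm y x, hxy, hey, hc]; ring
  refine ⟨hyy, ?_⟩
  by_contra hneg
  push Not at hneg
  have cs := Finset.sum_mul_sq_le_sq_mul_sq Finset.univ (fun i : Fin n => x i.succ)
    (fun i : Fin n => y i.succ)
  have h1 : ∑ i : Fin n, x i.succ ^ 2 = x 0 ^ 2 - 1 := by
    simp only [lorentzForm, ← pow_two] at hx; linarith
  have h2 : ∑ i : Fin n, y i.succ ^ 2 = y 0 ^ 2 - 1 := by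
    simp only [lorentzForm, ← pow_two] at hyy; linarith
  rw [h1, h2] at cs
  have h3 : ∑ i : Fin n, x i.succ * y i.succ = x 0 * y 0 + lorentzForm x y := by
    simp only [lorentzForm]; ring
  rw [h3] at cs
  have h4 : x 0 * y 0 ≤ 0 := mul_nonpos_of_nonneg_of_nonpos hx0.le hneg
  have h5 : lorentzForm x y ≤ -1 := by rw [hxy]; nlinarith [sq_nonneg (lorentzForm x e)]
  have h6 : 0 ≤ y 0 ^ 2 - 1 := h2 ▸ Finset.sum_nonneg fun i _ => sq_nonneg _
  nlinarith [sq_nonneg (x 0)]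

/-- The image `x - 2⟨x, e⟩e` of `x` under the reflection in the hyperplane orthogonal to `e`. -/
def reflect (e : UnitNormal n) (x : HyperbolicSpace n) : HyperbolicSpace n :=
  ⟨x.1 - (2 * lorentzForm x.1 e.1) • e.1, reflect_mem e x⟩

theorem reflect_involutive (e : UnitNormal n) : Function.Involutive (reflect e) := by
  intro x
  refine Subtype.ext ?_
  have h : lorentzForm (x.1 - (2 * lorentzForm x.1 e.1) • e.1) e.1 = -lorentzForm x.1 e.1 := by
    have he := e.2
    have : ∀ c : ℝ, lorentzForm (x.1 - c • e.1) e.1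
        = lorentzForm x.1 e.1 - c * lorentzForm e.1 e.1 := by
      intro c
      simp only [lorentzForm, Pi.sub_apply, Pi.smul_apply, smul_eq_mul, sub_mul,
        Finset.sum_sub_distrib, mul_add, Finset.mul_sum, mul_assoc]
      ring
    rw [this, he]; ring
  simp only [reflect]
  rw [h]
  module

/-- The reflection in the hyperplane orthogonal to `e`. -/
def reflection (e : UnitNormal n) : Equiv.Perm (HyperbolicSpace n) :=
  (reflect_involutive e).toPerm _

/-- The convex polytope cut out by a family of half-spaces. -/
def polytope {B : Type*} (e : B → UnitNormal n) : Set (HyperbolicSpace n) :=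
  ⋂ i, halfSpace (e i)

/-- The group generated by the reflections in the faces of a polytope. -/
def reflectionGroup {B : Type*} (e : B → UnitNormal n) : Subgroup (Equiv.Perm (HyperbolicSpace n)) :=
  Subgroup.closure (Set.range fun i => reflection (e i))

end HyperbolicSpace

/-- A realization of a Coxeter system as an `n`-dimensional hyperbolic reflection group:
a convex polytope with non-empty interior such that assigning to each generator the reflection in
the corresponding face induces an isomorphism of the Coxeter group onto the group generated by
these reflections, which is a discrete group of isometries, that is, acts properly. -/
structure HyperbolicRealization {B Γ : Type*} [Group Γ] {M : CoxeterMatrix B}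
    (cs : CoxeterSystem M Γ) (n : ℕ) where
  normal : B → HyperbolicSpace.UnitNormal n
  interior_nonempty : (interior (HyperbolicSpace.polytope normal)).Nonempty
  iso : Γ ≃* HyperbolicSpace.reflectionGroup normal
  iso_simple : ∀ i, (iso (cs.simple i) : Equiv.Perm (HyperbolicSpace n)) =
    HyperbolicSpace.reflection (normal i)
  discrete : ProperlyDiscontinuousSMul (HyperbolicSpace.reflectionGroup normal)
    (HyperbolicSpace n)

namespace HyperbolicRealization

variable {B Γ : Type*} [Group Γ] {M : CoxeterMatrix B} {cs : CoxeterSystem M Γ} {n : ℕ}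

/-- The subgroup `P` of `Γ`, viewed as a group of transformations of hyperbolic space. -/
def image (R : HyperbolicRealization cs n) (P : Subgroup Γ) :
    Subgroup (Equiv.Perm (HyperbolicSpace n)) :=
  P.map ((HyperbolicSpace.reflectionGroup R.normal).subtype.comp R.iso.toMonoidHom)

/-- The quotient space of hyperbolic space by the subgroup `P`, with the quotient topology. -/
abbrev Quotient (R : HyperbolicRealization cs n) (P : Subgroup Γ) : Type :=
  MulAction.orbitRel.Quotient (R.image P) (HyperbolicSpace n)

/-- The quotient map. -/
def proj (R : HyperbolicRealization cs n) (P : Subgroup Γ) (x : HyperbolicSpace n) :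
    R.Quotient P :=
  Quotient.mk _ x

/-- A charted space structure on the quotient is a smooth structure for which the quotient map is
a local diffeomorphism. -/
def IsQuotientSmoothStructure (R : HyperbolicRealization cs n) (P : Subgroup Γ)
    (c : ChartedSpace (EuclideanSpace ℝ (Fin n)) (R.Quotient P)) : Prop :=
  IsManifold (𝓡 n) ∞ (R.Quotient P) ∧ IsLocalDiffeomorph (𝓡 n) (𝓡 n) ∞ (R.proj P)

end HyperbolicRealization

/-- A smooth `n`-manifold is orientable: smooth charts with orientation-preserving transition
maps cover it. -/
def IsOrientableManifold (n : ℕ) (X : Type*) [TopologicalSpace X]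
    [ChartedSpace (EuclideanSpace ℝ (Fin n)) X] : Prop :=
  ∃ A ⊆ IsManifold.maximalAtlas (𝓡 n) ∞ X, (∀ x, ∃ φ ∈ A, x ∈ φ.source) ∧
    ∀ φ ∈ A, ∀ ψ ∈ A, ∀ x ∈ φ.source ∩ ψ.source,
      0 < (fderiv ℝ (ψ ∘ φ.symm) (φ x)).det

end

/-! Everything reduces to the parity homomorphism ε from Γ to ℤ/2 that sends each generator to 1.
Orientability says that some vertex stabilizer lies in ker ε. As ker ε is normal, this condition is
constant on orbits, so for a transitive module any one stabilizer decides. The stabilizer of a pair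
in a tensor product lies in that of its first component, which gives the first part.

For the second part, hyperbolic space is identified with ℝⁿ by one global chart. There a reflection
has negative Jacobian everywhere (`det_fderiv_inCoords_reflect_neg`), so γ preserves orientation
exactly when ε(γ) is trivial. A torsion-free Π acts freely, because point stabilizers of a properly
discontinuous action are finite. Hence π : ℍⁿ → ℍⁿ/Π is a covering, and its local inverses give
smooth charts.

To compare orientations, each chart φ of the quotient is pulled back to φ ∘ π on ℝⁿ (`chartProj`),
whose Jacobian never vanishes and whose ratios are the Jacobians of the transition maps. If Π is
even, the charts with positive pulled-back Jacobian form an oriented atlas. Conversely, an oriented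
atlas gives a locally constant sign on ℝⁿ, constant by connectedness; since φ ∘ π is Π-invariant,
every element of Π must have positive Jacobian. -/

/-! ### Parity of words in a Coxeter group -/

theorem CoxeterSystem.lengthParity_wordProd {B W : Type*} [Group W] {M : CoxeterMatrix B}
    (cs : CoxeterSystem M W) (w : List B) :
    cs.lengthParity (cs.wordProd w) = Multiplicative.ofAdd (w.length : ZMod 2) := by
  rw [CoxeterSystem.wordProd, map_list_prod, List.map_map, cs.lengthParity_comp_simple,
    List.map_const', List.prod_replicate, ← ofAdd_nsmul, nsmul_one]

theorem CoxeterSystem.lengthParity_wordProd_eq_one_iff {B W : Type*} [Group W]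
    {M : CoxeterMatrix B} (cs : CoxeterSystem M W) (w : List B) :
    cs.lengthParity (cs.wordProd w) = 1 ↔ Even w.length := by
  rw [cs.lengthParity_wordProd, ofAdd_eq_one, ZMod.natCast_eq_zero_iff_even]

theorem CoxeterSystem.exists_even_word_iff {B W : Type*} [Group W]
    {M : CoxeterMatrix B} (cs : CoxeterSystem M W) (γ : W) :
    (∃ w : List B, Even w.length ∧ γ = cs.wordProd w) ↔ cs.lengthParity γ = 1 := by
  constructor
  · rintro ⟨w, hw, rfl⟩
    exact (cs.lengthParity_wordProd_eq_one_iff w).2 hw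
  · intro h
    obtain ⟨w, rfl⟩ := cs.wordProd_surjective γ
    exact ⟨w, (cs.lengthParity_wordProd_eq_one_iff w).1 h, rfl⟩

/-! ### Orientability through stabilizers, and tensor products -/

namespace PermutationModule

variable {Γ Ω U : Type*} [Group Γ] [AddCommGroup U] [Module ℂ U]
  {B : Type*} {M : CoxeterMatrix B}

/-- Every element is a word, and the parity of its length depends only on the element; so having no
odd word in a stabilizer means lying in the kernel of the parity homomorphism. -/
theorem isOrientable_iff_exists_stabilizer_even (V : PermutationModule Γ Ω U)
    (cs : CoxeterSystem M Γ) :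
    V.IsOrientable cs ↔ ∃ v, ∀ γ ∈ V.stabilizer v, cs.lengthParity γ = 1 := by
  refine exists_congr fun v => ⟨fun h γ hγ => ?_, fun h w hw hfix => ?_⟩
  · obtain ⟨w, rfl⟩ := cs.wordProd_surjective γ
    rw [cs.lengthParity_wordProd_eq_one_iff, ← Nat.not_odd_iff_even]
    exact fun hw => h w hw hγ
  · exact Nat.not_even_iff_odd.2 hw ((cs.lengthParity_wordProd_eq_one_iff w).1 (h _ hfix))

theorem conj_mem_stabilizer (V : PermutationModule Γ Ω U) {v v' : Ω} {γ δ : Γ}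
    (hδ : V.rep δ (V.basis v) = V.basis v') (hγ : γ ∈ V.stabilizer v') :
    δ⁻¹ * γ * δ ∈ V.stabilizer v := by
  change V.rep _ _ = _
  replace hγ : V.rep γ (V.basis v') = V.basis v' := hγ
  rw [map_mul, map_mul, Module.End.mul_apply, Module.End.mul_apply, hδ, hγ, ← hδ,
    Representation.inv_self_apply]

/-- Stabilizers along an orbit are conjugate, and a homomorphism to a commutative group does not see
conjugation. -/
theorem lengthParity_stabilizer_of_mem_orbit (V : PermutationModule Γ Ω U)
    (cs : CoxeterSystem M Γ) {v v' : Ω} (hv' : v' ∈ V.orbit v)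
    (h : ∀ γ ∈ V.stabilizer v, cs.lengthParity γ = 1) :
    ∀ γ ∈ V.stabilizer v', cs.lengthParity γ = 1 := by
  obtain ⟨δ, hδ⟩ := hv'
  intro γ hγ
  have := h _ (V.conj_mem_stabilizer hδ hγ)
  rwa [map_mul, map_mul, map_inv, mul_right_comm, inv_mul_cancel, one_mul] at this

theorem IsTransitive.isOrientable_iff_stabilizer_even {V : PermutationModule Γ Ω U}
    (hV : V.IsTransitive) (cs : CoxeterSystem M Γ) (v : Ω) :
    V.IsOrientable cs ↔ ∀ γ ∈ V.stabilizer v, cs.lengthParity γ = 1 := by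
  rw [isOrientable_iff_exists_stabilizer_even]
  exact ⟨fun ⟨v', h⟩ => V.lengthParity_stabilizer_of_mem_orbit cs (hV.2 v' v) h, fun h => ⟨v, h⟩⟩

theorem mem_orbit_self (V : PermutationModule Γ Ω U) (v : Ω) : v ∈ V.orbit v :=
  ⟨1, by simp⟩

theorem orbitModule_isOrientable (V : PermutationModule Γ Ω U) (cs : CoxeterSystem M Γ) (v : Ω)
    (h : ∀ γ ∈ V.stabilizer v, cs.lengthParity γ = 1) : (V.orbitModule v).IsOrientable cs := by
  rw [isOrientable_iff_exists_stabilizer_even]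
  refine ⟨⟨v, V.mem_orbit_self v⟩, fun γ hγ => h γ ?_⟩
  have := congrArg Subtype.val (show (V.orbitModule v).rep γ _ = _ from hγ)
  simp only [orbitModule, Module.Basis.span_apply] at this
  exact this

/-- Pure tensors could agree up to scalars without their factors agreeing; here both are basis
vectors, and injectivity of the product basis separates the components. -/
theorem stabilizer_tensor_le {Ω' U' : Type*} [AddCommGroup U'] [Module ℂ U']
    (V : PermutationModule Γ Ω U) (V' : PermutationModule Γ Ω' U') (p : Ω × Ω') :
    (V.tensor V').stabilizer p ≤ V.stabilizer p.1 := by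
  intro γ hγ
  obtain ⟨v, hv⟩ := V.permutes γ p.1
  obtain ⟨v', hv'⟩ := V'.permutes γ p.2
  have h : (V.tensor V').basis (v, v') = (V.tensor V').basis p := by
    rw [← show (V.tensor V').rep γ _ = _ from hγ]
    simp [tensor, Representation.tprod_apply, Module.Basis.tensorProduct_apply', hv, hv']
  obtain rfl := (V.tensor V').basis.injective h
  exact hv

theorem tensor_orientable (cs : CoxeterSystem M Γ) {Ω' U' : Type*} [AddCommGroup U'] [Module ℂ U']
    [hΩ' : Nonempty Ω'] (V : PermutationModule Γ Ω U) (V' : PermutationModule Γ Ω' U')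
    (hV : V.IsOrientable cs) :
    (V.tensor V').IsOrientable cs ∧
      (∃ p, ((V.tensor V').orbitModule p).IsOrientable cs) ∧
      (V.IsTransitive → ∀ p, ((V.tensor V').orbitModule p).IsOrientable cs) := by
  have hV' := hV
  obtain ⟨v, hv⟩ := (V.isOrientable_iff_exists_stabilizer_even cs).1 hV
  obtain ⟨v'⟩ := hΩ'
  have h := fun γ hγ => hv γ (stabilizer_tensor_le V V' (v, v') hγ)
  refine ⟨(isOrientable_iff_exists_stabilizer_even _ cs).2 ⟨_, h⟩,
    ⟨_, orbitModule_isOrientable _ cs _ h⟩, fun ht p => orbitModule_isOrientable _ cs _ ?_⟩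
  exact fun γ hγ => (ht.isOrientable_iff_stabilizer_even cs p.1).1 hV' γ
    (stabilizer_tensor_le V V' p hγ)

end PermutationModule

/-! ### Jacobians of reflections in the global chart -/

theorem ContinuousLinearMap.det_mul_comp {R M : Type*} [CommRing R] [AddCommGroup M] [Module R M]
    [TopologicalSpace M] (f g : M →L[R] M) : (f.comp g).det = f.det * g.det :=
  LinearMap.det_comp _ _

theorem det_fderiv_comp {E : Type*} [NormedAddCommGroup E] [NormedSpace ℝ E] {f g : E → E} {y : E}
    (hf : DifferentiableAt ℝ f (g y)) (hg : DifferentiableAt ℝ g y) :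
    (fderiv ℝ (f ∘ g) y).det = (fderiv ℝ f (g y)).det * (fderiv ℝ g y).det := by
  rw [fderiv_comp _ hf hg, ContinuousLinearMap.det_mul_comp]

namespace HyperbolicSpace

variable {n : ℕ}

/-- The map `f` in the coordinates given by the projection to Euclidean space. -/
noncomputable def inCoords (f : HyperbolicSpace n → HyperbolicSpace n)
    (y : EuclideanSpace ℝ (Fin n)) : EuclideanSpace ℝ (Fin n) :=
  toEuclidean (f (toEuclidean.symm y))

/-- The Euclidean part of a vector. -/
noncomputable def spacePart (e : Fin (n + 1) → ℝ) : EuclideanSpace ℝ (Fin n) :=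
  WithLp.toLp 2 fun i => e i.succ

theorem inner_spacePart (x e : Fin (n + 1) → ℝ) :
    inner ℝ (spacePart x) (spacePart e) = lorentzForm x e + x 0 * e 0 := by
  simp [spacePart, lorentzForm, PiLp.inner_apply, mul_comm]

theorem toEuclidean_symm_zero (y : EuclideanSpace ℝ (Fin n)) :
    (toEuclidean.symm y).1 0 = √(1 + ‖y‖ ^ 2) := by
  rw [EuclideanSpace.real_norm_sq_eq]
  rfl

theorem lorentzForm_toEuclidean_symm (e : Fin (n + 1) → ℝ) (y : EuclideanSpace ℝ (Fin n)) :
    lorentzForm (toEuclidean.symm y).1 e = inner ℝ (spacePart e) y - √(1 + ‖y‖ ^ 2) * e 0 := by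
  have h : spacePart (toEuclidean.symm y).1 = y := toEuclidean.apply_symm_apply y
  rw [eq_sub_iff_add_eq, ← toEuclidean_symm_zero, ← inner_spacePart, h, real_inner_comm]

/-- The displacement always points along one fixed vector, so the derivative is a rank-one
perturbation of the identity. -/
theorem inCoords_reflect (e : UnitNormal n) (y : EuclideanSpace ℝ (Fin n)) :
    inCoords (reflect e) y =
      y + (-2 * (inner ℝ (spacePart e.1) y - √(1 + ‖y‖ ^ 2) * e.1 0)) • spacePart e.1 := by
  have h : spacePart (toEuclidean.symm y).1 = y := toEuclidean.apply_symm_apply y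
  nth_rw 2 [← h]
  rw [← lorentzForm_toEuclidean_symm]
  ext i
  change (toEuclidean.symm y).1 i.succ - 2 * _ * e.1 i.succ =
    (toEuclidean.symm y).1 i.succ + -2 * _ * e.1 i.succ
  ring

theorem contDiff_inCoords_reflect (e : UnitNormal n) : ContDiff ℝ ∞ (inCoords (reflect e)) := by
  have hs : ContDiff ℝ ∞ fun y : EuclideanSpace ℝ (Fin n) => √(1 + ‖y‖ ^ 2) :=
    (contDiff_const.add (contDiff_norm_sq ℝ)).sqrt fun y => by positivity
  rw [funext (inCoords_reflect e)]
  exact contDiff_id.add ((contDiff_const.mul (((innerSL ℝ (spacePart e.1)).contDiff).sub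
    (hs.mul contDiff_const))).smul contDiff_const)

/-- The derivative is v ↦ v + l(v)e', with e' the Euclidean part of e, and has determinant 1 +
l(e'). Multiplied by s, the height of the point above y, this is minus the height of the reflected
point, which is positive because reflections preserve the upper sheet. -/
theorem det_fderiv_inCoords_reflect_neg (e : UnitNormal n) (y : EuclideanSpace ℝ (Fin n)) :
    (fderiv ℝ (inCoords (reflect e)) y).det < 0 := by
  set s := √(1 + ‖y‖ ^ 2) with hs
  have hs0 : 0 < s := Real.sqrt_pos.2 (by positivity)
  set l : EuclideanSpace ℝ (Fin n) →L[ℝ] ℝ :=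
    (-2 : ℝ) • (innerSL ℝ (spacePart e.1) - (e.1 0 / s) • innerSL ℝ y) with hl
  have hd : HasFDerivAt (inCoords (reflect e))
      (ContinuousLinearMap.id ℝ _ + l.smulRight (spacePart e.1)) y := by
    rw [funext (inCoords_reflect e)]
    have h1 : HasFDerivAt (fun y : EuclideanSpace ℝ (Fin n) => √(1 + ‖y‖ ^ 2))
        ((1 / s) • innerSL ℝ y) y := by
      have := (((hasStrictFDerivAt_norm_sq y).hasFDerivAt).const_add 1).sqrt (by positivity)
      refine this.congr_fderiv (ContinuousLinearMap.ext fun v => ?_)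
      simp
      field_simp
      rw [hs, mul_comm]
    have h2 := ((((innerSL ℝ (spacePart e.1)).hasFDerivAt (x := y)).sub
      (h1.mul_const (e.1 0))).const_mul (-2))
    refine ((hasFDerivAt_id y).add (h2.smul_const (spacePart e.1))).congr_fderiv
      (ContinuousLinearMap.ext fun v => ?_)
    simp [hl]
    congr 1
    ring
  rw [hd.fderiv]
  have hdet : (ContinuousLinearMap.id ℝ _ + l.smulRight (spacePart e.1)).det
      = 1 + l (spacePart e.1) :=
    LinearMap.transvection.det l.toLinearMap (spacePart e.1)
  have hpos := (reflect_mem e (toEuclidean.symm y)).2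
  simp only [Pi.sub_apply, Pi.smul_apply, toEuclidean_symm_zero, smul_eq_mul,
    lorentzForm_toEuclidean_symm, ← hs] at hpos
  rw [hdet, hl]
  simp only [smul_apply, sub_apply, innerSL_apply_apply,
    inner_spacePart, e.2, smul_eq_mul]
  rw [real_inner_comm] at hpos
  refine neg_of_mul_neg_right (a := s) ?_ hs0.le
  field_simp
  linarith

/-- The map `f` is smooth with Jacobian determinant of sign `ε` everywhere. -/
def IsSmoothOfSign (ε : ℝ) (f : HyperbolicSpace n → HyperbolicSpace n) : Prop :=
  ContDiff ℝ ∞ (inCoords f) ∧ ∀ y, 0 < ε * (fderiv ℝ (inCoords f) y).det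

theorem inCoords_comp (f g : HyperbolicSpace n → HyperbolicSpace n) :
    inCoords (f ∘ g) = inCoords f ∘ inCoords g := by
  ext1 y
  simp [inCoords]

theorem IsSmoothOfSign.comp {ε δ : ℝ} {f g : HyperbolicSpace n → HyperbolicSpace n}
    (hf : IsSmoothOfSign ε f) (hg : IsSmoothOfSign δ g) : IsSmoothOfSign (ε * δ) (f ∘ g) := by
  unfold IsSmoothOfSign
  rw [inCoords_comp]
  refine ⟨hf.1.comp hg.1, fun y => ?_⟩
  rw [det_fderiv_comp (hf.1.differentiable (by simp) _) (hg.1.differentiable (by simp) _),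
    mul_mul_mul_comm]
  exact mul_pos (hf.2 _) (hg.2 _)

theorem isSmoothOfSign_id : IsSmoothOfSign 1 (id : HyperbolicSpace n → HyperbolicSpace n) := by
  have : inCoords (id : HyperbolicSpace n → _) = id := by
    ext1 y
    simp [inCoords]
  rw [IsSmoothOfSign, this]
  exact ⟨contDiff_id, fun y => by simp [ContinuousLinearMap.det]⟩

theorem isSmoothOfSign_reflection (e : UnitNormal n) : IsSmoothOfSign (-1) (reflection e) :=
  ⟨contDiff_inCoords_reflect e, fun y => by
    have := det_fderiv_inCoords_reflect_neg e y
    change 0 < -1 * (fderiv ℝ (inCoords (reflect e)) y).det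
    linarith⟩

theorem IsSmoothOfSign.continuous {ε : ℝ} {f : HyperbolicSpace n → HyperbolicSpace n}
    (hf : IsSmoothOfSign ε f) : Continuous f := by
  have h : f = toEuclidean.symm ∘ inCoords f ∘ toEuclidean := by
    ext1 x
    simp [inCoords]
  rw [h]
  exact toEuclidean.symm.continuous.comp (hf.1.continuous.comp toEuclidean.continuous)

end HyperbolicSpace

/-! ### Orientation character of the Coxeter group action -/

namespace HyperbolicRealization

open HyperbolicSpace

variable {B Γ : Type*} [Group Γ] {M : CoxeterMatrix B} {cs : CoxeterSystem M Γ} {n : ℕ}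

/-- The action of the Coxeter group on hyperbolic space. -/
def act (R : HyperbolicRealization cs n) : Γ →* Equiv.Perm (HyperbolicSpace n) :=
  (HyperbolicSpace.reflectionGroup R.normal).subtype.comp R.iso.toMonoidHom

theorem isSmoothOfSign_act_wordProd (R : HyperbolicRealization cs n) (w : List B) :
    IsSmoothOfSign ((-1) ^ w.length) (R.act (cs.wordProd w)) := by
  induction w with
  | nil => simpa using isSmoothOfSign_id
  | cons i w ih =>
    rw [CoxeterSystem.wordProd_cons, map_mul, List.length_cons, pow_succ']
    have h : R.act (cs.simple i) = reflection (R.normal i) := R.iso_simple i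
    rw [h, Equiv.Perm.coe_mul]
    exact (isSmoothOfSign_reflection _).comp ih

end HyperbolicRealization

/-! ### Topology and smooth structure of hyperbolic space -/

namespace HyperbolicSpace

variable {n : ℕ}

instance : T2Space (HyperbolicSpace n) :=
  toEuclidean.isEmbedding.t2Space

instance : LocallyCompactSpace (HyperbolicSpace n) :=
  toEuclidean.isClosedEmbedding.locallyCompactSpace

instance : SecondCountableTopology (HyperbolicSpace n) :=
  toEuclidean.isEmbedding.secondCountableTopology

instance : IsManifold (𝓡 n) ∞ (HyperbolicSpace n) :=
  toEuclidean.toOpenPartialHomeomorph.isManifold_singleton rfl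

theorem contMDiff_toEuclidean : ContMDiff (𝓡 n) (𝓡 n) ∞ (toEuclidean (n := n)) :=
  contMDiffOn_univ.1
    -- The atlas has a single, globally defined chart, so the base point is arbitrary.
    (contMDiffOn_chart (x := toEuclidean.symm (0 : EuclideanSpace ℝ (Fin n))))

theorem contMDiff_toEuclidean_symm :
    ContMDiff (𝓡 n) (𝓡 n) ∞ (toEuclidean (n := n)).symm :=
  contMDiffOn_univ.1
    (contMDiffOn_chart_symm (x := toEuclidean.symm (0 : EuclideanSpace ℝ (Fin n))))

end HyperbolicSpace

/-! ### The quotient as a manifold -/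

namespace HyperbolicRealization

open HyperbolicSpace

variable {B Γ : Type*} [Group Γ] {M : CoxeterMatrix B} {cs : CoxeterSystem M Γ} {n : ℕ}
  (R : HyperbolicRealization cs n) (P : Subgroup Γ)

theorem act_injective : Function.Injective R.act :=
  Subtype.val_injective.comp R.iso.injective

theorem continuous_act (γ : Γ) : Continuous (R.act γ) := by
  obtain ⟨w, rfl⟩ := cs.wordProd_surjective γ
  exact (R.isSmoothOfSign_act_wordProd w).continuous

theorem contDiff_inCoords_act (γ : Γ) : ContDiff ℝ ∞ (inCoords (R.act γ)) := by
  obtain ⟨w, rfl⟩ := cs.wordProd_surjective γ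
  exact (R.isSmoothOfSign_act_wordProd w).1

/-- The sign of the Jacobian does not depend on y, so testing it at a single point determines the
parity of γ. -/
theorem det_fderiv_inCoords_act_pos_iff (γ : Γ) (y : EuclideanSpace ℝ (Fin n)) :
    0 < (fderiv ℝ (inCoords (R.act γ)) y).det ↔ cs.lengthParity γ = 1 := by
  obtain ⟨w, rfl⟩ := cs.wordProd_surjective γ
  have h := (R.isSmoothOfSign_act_wordProd w).2 y
  rw [cs.lengthParity_wordProd_eq_one_iff]
  rcases Nat.even_or_odd w.length with hw | hw
  · rw [hw.neg_one_pow, one_mul] at h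
    exact iff_of_true h hw
  · rw [hw.neg_one_pow] at h
    exact iff_of_false (by linarith) (Nat.not_even_iff_odd.2 hw)

theorem proj_eq_iff {x y : HyperbolicSpace n} :
    R.proj P x = R.proj P y ↔ ∃ γ ∈ P, R.act γ y = x := by
  refine Quotient.eq''.trans ⟨?_, ?_⟩
  · rintro ⟨⟨_, γ, hγ, rfl⟩, h⟩
    exact ⟨γ, hγ, h⟩
  · rintro ⟨γ, hγ, h⟩
    exact ⟨⟨_, γ, hγ, rfl⟩, h⟩

theorem proj_act {γ : Γ} (hγ : γ ∈ P) (x : HyperbolicSpace n) :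
    R.proj P (R.act γ x) = R.proj P x :=
  (R.proj_eq_iff P).2 ⟨γ, hγ, rfl⟩

theorem proj_surjective : Function.Surjective (R.proj P) :=
  Quotient.mk_surjective

instance : ContinuousConstSMul (R.image P) (HyperbolicSpace n) where
  continuous_const_smul := by
    rintro ⟨_, γ, -, rfl⟩
    exact R.continuous_act γ

instance : ProperlyDiscontinuousSMul (R.image P) (HyperbolicSpace n) := by
  refine Subgroup.properlyDiscontinuousSMul_of_le R.discrete ?_
  rintro _ ⟨γ, -, rfl⟩
  exact (R.iso γ).2

theorem t2Space_quotient : T2Space (R.Quotient P) :=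
  t2Space_of_properlyDiscontinuousSMul_of_t2Space

theorem secondCountableTopology_quotient : SecondCountableTopology (R.Quotient P) :=
  ContinuousConstSMul.secondCountableTopology

variable {P}

/-- Proper discontinuity makes point stabilizers finite, so an element with a fixed point has finite
order. Faithfulness of the action carries this back to Γ, where the hypothesis applies. -/
theorem isCancelSMul_image (hP : ∀ γ ∈ P, IsOfFinOrder γ → γ = 1) :
    IsCancelSMul (R.image P) (HyperbolicSpace n) := by
  rw [isCancelSMul_iff_eq_one_of_smul_eq]
  intro g x hgx
  have hfin : Finite (MulAction.stabilizer (R.image P) x) :=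
    ProperlyDiscontinuousSMul.finite_stabilizer x
  have hg : IsOfFinOrder (⟨g, hgx⟩ : MulAction.stabilizer (R.image P) x) :=
    isOfFinOrder_of_finite _
  obtain ⟨_, γ, hγ, rfl⟩ := g
  have h : IsOfFinOrder (R.act γ) :=
    (R.image P).subtype.isOfFinOrder
      ((MulAction.stabilizer (R.image P) x).subtype.isOfFinOrder hg)
  rw [R.act_injective.isOfFinOrder_iff] at h
  refine Subtype.ext ?_
  exact (congrArg R.act (hP γ hγ h)).trans (map_one R.act)

theorem isLocalHomeomorph_proj (hP : ∀ γ ∈ P, IsOfFinOrder γ → γ = 1) :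
    IsLocalHomeomorph (R.proj P) :=
  have := R.isCancelSMul_image hP
  isQuotientCoveringMap_quotientMk_of_properlyDiscontinuousSMul.isCoveringMap.isLocalHomeomorph

/-- A local inverse of π applied to π(x) lies in the orbit of x, hence equals γx for some γ; near x
both sides lie over the same point and in the region where π is injective. Agreement with π is asked
only on the source, which is all that a local diffeomorphism provides. -/
theorem eventually_symm_proj_eq_act (τ : OpenPartialHomeomorph (HyperbolicSpace n) (R.Quotient P))
    (hτ : Set.EqOn (R.proj P) τ τ.source) {x : HyperbolicSpace n} (hx : R.proj P x ∈ τ.target) :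
    ∃ γ ∈ P, ∀ᶠ x' in nhds x, τ.symm (R.proj P x') = R.act γ x' := by
  have hz := τ.map_target hx
  obtain ⟨γ, hγ, h⟩ := (R.proj_eq_iff P).1 ((hτ hz).trans (τ.right_inv hx))
  refine ⟨γ, hγ, ?_⟩
  rw [← h] at hz
  filter_upwards [(R.continuous_act γ).continuousAt.eventually_mem (τ.open_source.mem_nhds hz)]
    with x' hx'
  rw [← R.proj_act P hγ, hτ hx', τ.left_inv hx']

theorem contDiffAt_section_transition
    (τ : OpenPartialHomeomorph (HyperbolicSpace n) (R.Quotient P))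
    (hτ : Set.EqOn (R.proj P) τ τ.source) {y : EuclideanSpace ℝ (Fin n)}
    (hy : R.proj P (toEuclidean.symm y) ∈ τ.target) :
    ContDiffAt ℝ ∞ (fun y => toEuclidean (τ.symm (R.proj P (toEuclidean.symm y)))) y := by
  obtain ⟨γ, -, h⟩ := R.eventually_symm_proj_eq_act τ hτ hy
  refine (R.contDiff_inCoords_act γ).contDiffAt.congr_of_eventuallyEq ?_
  filter_upwards [toEuclidean.symm.continuous.continuousAt.eventually h] with y' hy'
  rw [hy', inCoords]

/-- The charts of the quotient given by the local sections of the quotient map. -/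
noncomputable abbrev quotientChartedSpace (h : IsLocalHomeomorph (R.proj P)) :
    ChartedSpace (EuclideanSpace ℝ (Fin n)) (R.Quotient P) where
  atlas := {φ | ∃ σ : OpenPartialHomeomorph (HyperbolicSpace n) (R.Quotient P),
    R.proj P = σ ∧ φ = σ.symm.trans toEuclidean.toOpenPartialHomeomorph}
  chartAt q := (h (R.proj_surjective P q).choose).choose.symm.trans
    toEuclidean.toOpenPartialHomeomorph
  mem_chart_source q := by
    obtain ⟨h1, h2⟩ := (h (R.proj_surjective P q).choose).choose_spec
    have := OpenPartialHomeomorph.map_source _ h1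
    rw [← h2, (R.proj_surjective P q).choose_spec] at this
    simpa using this
  chart_mem_atlas q := ⟨_, (h (R.proj_surjective P q).choose).choose_spec.2, rfl⟩

theorem isQuotientSmoothStructure_quotientChartedSpace (h : IsLocalHomeomorph (R.proj P)) :
    R.IsQuotientSmoothStructure P (R.quotientChartedSpace h) := by
  let := R.quotientChartedSpace h
  have hman : IsManifold (𝓡 n) ∞ (R.Quotient P) := by
    refine isManifold_of_contDiffOn _ _ _ ?_
    rintro _ _ ⟨σ, hσ, rfl⟩ ⟨τ, hτ, rfl⟩ y hy
    have hy' : R.proj P (toEuclidean.symm y) ∈ τ.target := by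
      rw [hσ]
      simpa using hy.1.2
    have := R.contDiffAt_section_transition τ (fun x _ => by rw [hτ]) hy'
    rw [hσ] at this
    exact this.contDiffWithinAt
  refine ⟨hman, fun x => ?_⟩
  obtain ⟨σ, hx, hσ⟩ := h x
  have hmem : σ.symm.trans toEuclidean.toOpenPartialHomeomorph ∈
      IsManifold.maximalAtlas (𝓡 n) ∞ (R.Quotient P) :=
    IsManifold.subset_maximalAtlas ⟨σ, hσ, rfl⟩
  -- On its source σ is the inverse of the chart it defines, precomposed with `toEuclidean`; so its
  -- smoothness, and that of its inverse, follow from those of an atlas chart.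
  refine ⟨⟨σ.toPartialEquiv, σ.open_source, σ.open_target, ?_, ?_⟩, hx, fun x _ => by rw [hσ]; rfl⟩
  · have := (contMDiffOn_symm_of_mem_maximalAtlas hmem).comp
      (contMDiff_toEuclidean.contMDiffOn (s := σ.source)) (by intro x hx; simpa using hx)
    refine this.congr fun x hx => ?_
    simp
  · have := contMDiff_toEuclidean_symm.comp_contMDiffOn (contMDiffOn_of_mem_maximalAtlas hmem)
    refine (this.mono (t := σ.target) (by intro x hx; simpa using hx)).congr fun x hx => ?_
    simp

end HyperbolicRealization

/-! ### Orientability of the quotient -/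

namespace HyperbolicRealization

open HyperbolicSpace

variable {B Γ : Type*} [Group Γ] {M : CoxeterMatrix B} {cs : CoxeterSystem M Γ} {n : ℕ}
  (R : HyperbolicRealization cs n) {P : Subgroup Γ}

/-- The quotient map in a chart of the quotient and the coordinates of hyperbolic space. -/
noncomputable def chartProj
    (φ : OpenPartialHomeomorph (R.Quotient P) (EuclideanSpace ℝ (Fin n)))
    (y : EuclideanSpace ℝ (Fin n)) : EuclideanSpace ℝ (Fin n) :=
  φ (R.proj P (toEuclidean.symm y))

theorem continuous_proj_coords :
    Continuous fun y : EuclideanSpace ℝ (Fin n) => R.proj P (toEuclidean.symm y) :=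
  continuous_quot_mk.comp toEuclidean.symm.continuous

theorem isOpen_chartProj_domain
    (φ : OpenPartialHomeomorph (R.Quotient P) (EuclideanSpace ℝ (Fin n))) :
    IsOpen {y | R.proj P (toEuclidean.symm y) ∈ φ.source} :=
  φ.open_source.preimage R.continuous_proj_coords

theorem chartProj_inCoords_act
    (φ : OpenPartialHomeomorph (R.Quotient P) (EuclideanSpace ℝ (Fin n)))
    {γ : Γ} (hγ : γ ∈ P) : R.chartProj φ ∘ inCoords (R.act γ) = R.chartProj φ := by
  ext1 y
  simp [chartProj, inCoords, R.proj_act P hγ]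

variable [c : ChartedSpace (EuclideanSpace ℝ (Fin n)) (R.Quotient P)]
  {φ ψ : OpenPartialHomeomorph (R.Quotient P) (EuclideanSpace ℝ (Fin n))}

theorem contDiffOn_chartProj (hc : R.IsQuotientSmoothStructure P c)
    (hφ : φ ∈ IsManifold.maximalAtlas (𝓡 n) ∞ (R.Quotient P)) :
    ContDiffOn ℝ ∞ (R.chartProj φ) {y | R.proj P (toEuclidean.symm y) ∈ φ.source} :=
  contMDiffOn_iff_contDiffOn.1 <| (contMDiffOn_of_mem_maximalAtlas hφ).comp
    (hc.2.contMDiff.comp contMDiff_toEuclidean_symm).contMDiffOn fun _ hy => hy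

theorem differentiableAt_chartProj (hc : R.IsQuotientSmoothStructure P c)
    (hφ : φ ∈ IsManifold.maximalAtlas (𝓡 n) ∞ (R.Quotient P)) {y : EuclideanSpace ℝ (Fin n)}
    (hy : R.proj P (toEuclidean.symm y) ∈ φ.source) : DifferentiableAt ℝ (R.chartProj φ) y :=
  ((R.contDiffOn_chartProj hc hφ).contDiffAt
    ((R.isOpen_chartProj_domain φ).mem_nhds hy)).differentiableAt (by simp)

theorem continuousOn_det_fderiv_chartProj (hc : R.IsQuotientSmoothStructure P c)
    (hφ : φ ∈ IsManifold.maximalAtlas (𝓡 n) ∞ (R.Quotient P)) :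
    ContinuousOn (fun y => (fderiv ℝ (R.chartProj φ) y).det)
      {y | R.proj P (toEuclidean.symm y) ∈ φ.source} :=
  ContinuousLinearMap.continuous_det.comp_continuousOn
    ((R.contDiffOn_chartProj hc hφ).continuousOn_fderiv_of_isOpen (R.isOpen_chartProj_domain φ)
      (by simp))

/-- Chain rule for ψ ∘ π = (ψ ∘ φ⁻¹) ∘ (φ ∘ π). It turns signs of transition maps into a comparison
of functions on ℝⁿ. -/
theorem det_fderiv_transition_mul (hc : R.IsQuotientSmoothStructure P c)
    (hφ : φ ∈ IsManifold.maximalAtlas (𝓡 n) ∞ (R.Quotient P))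
    (hψ : ψ ∈ IsManifold.maximalAtlas (𝓡 n) ∞ (R.Quotient P)) {y : EuclideanSpace ℝ (Fin n)}
    (hyφ : R.proj P (toEuclidean.symm y) ∈ φ.source)
    (hyψ : R.proj P (toEuclidean.symm y) ∈ ψ.source) :
    (fderiv ℝ (ψ ∘ φ.symm) (R.chartProj φ y)).det * (fderiv ℝ (R.chartProj φ) y).det =
      (fderiv ℝ (R.chartProj ψ) y).det := by
  have hd : DifferentiableAt ℝ (ψ ∘ φ.symm) (R.chartProj φ y) := by
    refine (contMDiffAt_iff_contDiffAt.1 ?_ : ContDiffAt ℝ ∞ _ _).differentiableAt (by simp)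
    refine ContMDiffAt.comp _ ?_ (contMDiffAt_symm_of_mem_maximalAtlas hφ (φ.map_source hyφ))
    exact contMDiffAt_of_mem_maximalAtlas hψ ((φ.left_inv hyφ).symm ▸ hyψ)
  rw [← det_fderiv_comp hd (R.differentiableAt_chartProj hc hφ hyφ)]
  congr 1
  refine Filter.EventuallyEq.fderiv_eq ?_
  filter_upwards [(R.isOpen_chartProj_domain φ).mem_nhds hyφ] with y' hy'
  exact congrArg ψ (φ.left_inv hy')

/-- The chart is a local inverse of π followed by `toEuclidean`. It is compatible with the given
structure because π is a local diffeomorphism for it, and its pullback to ℝⁿ is locally an element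
of the group. -/
theorem exists_chart_chartProj_eventuallyEq (hc : R.IsQuotientSmoothStructure P c)
    (q : R.Quotient P) :
    ∃ ψ ∈ IsManifold.maximalAtlas (𝓡 n) ∞ (R.Quotient P), q ∈ ψ.source ∧
      ∀ y, R.proj P (toEuclidean.symm y) ∈ ψ.source →
        ∃ γ ∈ P, R.chartProj ψ =ᶠ[nhds y] inCoords (R.act γ) := by
  have := hc.1
  obtain ⟨x, rfl⟩ := R.proj_surjective P q
  obtain ⟨Φ, hx, hΦ⟩ := hc.2 x
  set σ := Φ.toOpenPartialHomeomorph
  have hσ : Set.EqOn (R.proj P) σ σ.source := hΦ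
  refine ⟨σ.symm.trans toEuclidean.toOpenPartialHomeomorph, ?_, ?_, fun y hy => ?_⟩
  · refine OpenPartialHomeomorph.mem_maximalAtlas_of_contMDiffOn _ ?_ ?_
    · exact contMDiff_toEuclidean.comp_contMDiffOn
        (Φ.contMDiffOn_invFun.mono fun q hq => hq.1)
    · exact Φ.contMDiffOn_toFun.comp contMDiff_toEuclidean_symm.contMDiffOn
        fun y hy => hy.2
  · rw [hσ hx]
    simpa using σ.map_source hx
  · have hy' : R.proj P (toEuclidean.symm y) ∈ σ.target := by simpa using hy
    obtain ⟨γ, hγ, h⟩ := R.eventually_symm_proj_eq_act σ hσ hy'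
    refine ⟨γ, hγ, ?_⟩
    filter_upwards [toEuclidean.symm.continuous.continuousAt.eventually h] with y' hy'
    exact congrArg HyperbolicSpace.toEuclidean hy'

theorem det_fderiv_inCoords_act_ne_zero (γ : Γ) (y : EuclideanSpace ℝ (Fin n)) :
    (fderiv ℝ (inCoords (R.act γ)) y).det ≠ 0 := by
  obtain ⟨w, rfl⟩ := cs.wordProd_surjective γ
  exact right_ne_zero_of_mul ((R.isSmoothOfSign_act_wordProd w).2 y).ne'

/-- Composing φ ∘ π with a transition to a section chart yields locally a group element, whose
Jacobian is nonzero; neither factor can then vanish. -/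
theorem det_fderiv_chartProj_ne_zero (hc : R.IsQuotientSmoothStructure P c)
    (hφ : φ ∈ IsManifold.maximalAtlas (𝓡 n) ∞ (R.Quotient P)) {y : EuclideanSpace ℝ (Fin n)}
    (hy : R.proj P (toEuclidean.symm y) ∈ φ.source) : (fderiv ℝ (R.chartProj φ) y).det ≠ 0 := by
  obtain ⟨ψ, hψ, hyψ, h⟩ := R.exists_chart_chartProj_eventuallyEq hc (R.proj P (toEuclidean.symm y))
  obtain ⟨γ, -, hγ⟩ := h y hyψ
  have := R.det_fderiv_transition_mul hc hφ hψ hy hyψ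
  rw [hγ.fderiv_eq] at this
  exact right_ne_zero_of_mul (this ▸ R.det_fderiv_inCoords_act_ne_zero γ y)

/-- This is the derivative of the invariance φ ∘ π ∘ γ = φ ∘ π. -/
theorem det_fderiv_chartProj_mul_act (hc : R.IsQuotientSmoothStructure P c)
    (hφ : φ ∈ IsManifold.maximalAtlas (𝓡 n) ∞ (R.Quotient P)) {γ : Γ} (hγ : γ ∈ P)
    {y : EuclideanSpace ℝ (Fin n)} (hy : R.proj P (toEuclidean.symm y) ∈ φ.source) :
    (fderiv ℝ (R.chartProj φ) (inCoords (R.act γ) y)).det *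
      (fderiv ℝ (inCoords (R.act γ)) y).det = (fderiv ℝ (R.chartProj φ) y).det := by
  have hy' : R.proj P (toEuclidean.symm (inCoords (R.act γ) y)) ∈ φ.source := by
    simpa [inCoords, R.proj_act P hγ] using hy
  rw [← det_fderiv_comp (R.differentiableAt_chartProj hc hφ hy')
    ((R.contDiff_inCoords_act γ).differentiable (by simp) y), R.chartProj_inCoords_act φ hγ]

theorem isOrientableManifold_of_even (hc : R.IsQuotientSmoothStructure P c)
    (hP : ∀ γ ∈ P, cs.lengthParity γ = 1) : IsOrientableManifold n (R.Quotient P) := by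
  -- The oriented atlas consists of the charts that preserve orientation when pulled back to ℝⁿ;
  -- evenness puts the section charts among them, so they cover.
  refine ⟨{φ ∈ IsManifold.maximalAtlas (𝓡 n) ∞ (R.Quotient P) |
    ∀ y, R.proj P (toEuclidean.symm y) ∈ φ.source → 0 < (fderiv ℝ (R.chartProj φ) y).det},
    fun φ hφ => hφ.1, fun q => ?_, fun φ hφ ψ hψ q hq => ?_⟩
  · obtain ⟨ψ, hψ, hq, h⟩ := R.exists_chart_chartProj_eventuallyEq hc q
    refine ⟨ψ, ⟨hψ, fun y hy => ?_⟩, hq⟩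
    obtain ⟨γ, hγ, hγy⟩ := h y hy
    rw [hγy.fderiv_eq]
    exact (R.det_fderiv_inCoords_act_pos_iff γ y).2 (hP γ hγ)
  · obtain ⟨x, rfl⟩ := R.proj_surjective P q
    obtain ⟨y, rfl⟩ := toEuclidean.symm.surjective x
    have h := R.det_fderiv_transition_mul hc hφ.1 hψ.1 hq.1 hq.2
    exact pos_of_mul_pos_left (h ▸ hψ.2 y hq.2) (hφ.2 y hq.1).le

/-- An oriented atlas pulls back to an orientation of ℝⁿ, which agrees everywhere with the standard
one or everywhere with its opposite. The pulled-back orientation is invariant under γ, so γ has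
positive Jacobian. -/
theorem even_of_isOrientableManifold (hc : R.IsQuotientSmoothStructure P c)
    (h : IsOrientableManifold n (R.Quotient P)) {γ : Γ} (hγ : γ ∈ P) : cs.lengthParity γ = 1 := by
  obtain ⟨A, hA, hcov, hpos⟩ := h
  choose Φ hΦA hΦ using fun y : EuclideanSpace ℝ (Fin n) => hcov (R.proj P (toEuclidean.symm y))
  have hsign : ∀ φ ∈ A, ∀ ψ ∈ A, ∀ y, R.proj P (toEuclidean.symm y) ∈ φ.source →
      R.proj P (toEuclidean.symm y) ∈ ψ.source →
      (0 < (fderiv ℝ (R.chartProj φ) y).det ↔ 0 < (fderiv ℝ (R.chartProj ψ) y).det) := by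
    intro φ hφ ψ hψ y hyφ hyψ
    rw [← R.det_fderiv_transition_mul hc (hA hφ) (hA hψ) hyφ hyψ]
    exact (mul_pos_iff_of_pos_left (hpos φ hφ ψ hψ _ ⟨hyφ, hyψ⟩)).symm
  -- Near y the chart `Φ y` may replace the varying `Φ y'` by `hsign`; in this fixed chart the
  -- Jacobian is continuous and nonzero, so it keeps its sign.
  have hconst : IsLocallyConstant fun y => 0 < (fderiv ℝ (R.chartProj (Φ y)) y).det := by
    rw [IsLocallyConstant.iff_eventually_eq]
    intro y
    have hnhds := (R.isOpen_chartProj_domain (Φ y)).mem_nhds (hΦ y)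
    have hcont := (R.continuousOn_det_fderiv_chartProj hc (hA (hΦA y))).continuousAt hnhds
    have hev : ∀ᶠ y' in nhds y, (0 < (fderiv ℝ (R.chartProj (Φ y)) y').det ↔
        0 < (fderiv ℝ (R.chartProj (Φ y)) y).det) := by
      rcases (R.det_fderiv_chartProj_ne_zero hc (hA (hΦA y)) (hΦ y)).lt_or_gt with hlt | hgt
      · filter_upwards [hcont.eventually_lt_const hlt] with y' hy'
        exact iff_of_false hy'.not_gt hlt.not_gt
      · filter_upwards [hcont.eventually_const_lt hgt] with y' hy'
        exact iff_of_true hy' hgt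
    filter_upwards [hev, hnhds] with y' hy' hmem
    exact propext ((hsign _ (hΦA y') _ (hΦA y) y' (hΦ y') hmem).trans hy')
  -- Any base point would do. Its translate z has the same image in the quotient, so the chart
  -- chosen at z also serves at y.
  set y : EuclideanSpace ℝ (Fin n) := 0
  set z := inCoords (R.act γ) y with hz
  have hyz : R.proj P (toEuclidean.symm z) = R.proj P (toEuclidean.symm y) := by
    simp [hz, inCoords, R.proj_act P hγ]
  have hmem : R.proj P (toEuclidean.symm y) ∈ (Φ z).source := hyz ▸ hΦ z
  have h1 := (iff_of_eq (hconst.apply_eq_of_preconnectedSpace z y)).trans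
    (hsign _ (hΦA y) _ (hΦA z) y (hΦ y) hmem)
  have h2 := R.det_fderiv_chartProj_mul_act hc (hA (hΦA z)) hγ hmem
  have h3 := R.det_fderiv_chartProj_ne_zero hc (hA (hΦA z)) (hΦ z)
  rw [← hz] at h2
  rw [← R.det_fderiv_inCoords_act_pos_iff γ y]
  -- The Jacobian of the pullback of `Φ z` has the same sign at y and at z, by `h1`, so the factor
  -- relating them in `h2` is positive.
  rcases h3.lt_or_gt with hlt | hgt
  · have hle : ¬ 0 < (fderiv ℝ (R.chartProj (Φ z)) y).det := h1.not.1 hlt.not_gt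
    have hne := R.det_fderiv_inCoords_act_ne_zero γ y
    by_contra hneg
    exact hle (h2 ▸ mul_pos_of_neg_of_neg hlt (lt_of_le_of_ne (not_lt.1 hneg) hne))
  · exact pos_of_mul_pos_right (h2 ▸ h1.1 hgt) hgt.le

theorem isOrientableManifold_iff (hc : R.IsQuotientSmoothStructure P c) :
    IsOrientableManifold n (R.Quotient P) ↔ ∀ γ ∈ P, cs.lengthParity γ = 1 :=
  ⟨fun h _ hγ => R.even_of_isOrientableManifold hc h hγ, R.isOrientableManifold_of_even hc⟩

end HyperbolicRealization

/-! ### Torsion-free modules and the main theorem -/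

theorem PermutationModule.IsTorsionFree.eq_one_of_isOfFinOrder {Γ Ω U : Type*} [Group Γ]
    [AddCommGroup U] [Module ℂ U] {V : PermutationModule Γ Ω U} (hV : V.IsTorsionFree)
    {P : Subgroup Γ} (hP : P ∈ V.correspondingSubgroups) :
    ∀ γ ∈ P, IsOfFinOrder γ → γ = 1 := by
  intro γ hγ hfin
  by_contra hne
  exact Set.disjoint_left.1 (hV γ hne hfin P hP) hγ mem_conjugatesOf_self

theorem mainTheorem11 {B : Type*} [Finite B] {M : CoxeterMatrix B}
    {Γ : Type*} [Group Γ] (cs : CoxeterSystem M Γ) :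
    (∀ (Ω₁ : Type*) (Ω₂ : Type*) (U₁ : Type*) (U₂ : Type*) [Finite Ω₁] [Finite Ω₂]
      [AddCommGroup U₁] [Module ℂ U₁] [AddCommGroup U₂] [Module ℂ U₂]
      (V₁ : PermutationModule Γ Ω₁ U₁) (V₂ : PermutationModule Γ Ω₂ U₂),
      V₁.IsOrientable cs → Nonempty Ω₂ →
        (V₁.tensor V₂).IsOrientable cs ∧
        (∃ p : Ω₁ × Ω₂, ((V₁.tensor V₂).orbitModule p).IsOrientable cs) ∧
        (V₁.IsTransitive → ∀ p : Ω₁ × Ω₂, ((V₁.tensor V₂).orbitModule p).IsOrientable cs)) ∧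
    (∀ (n : ℕ) (R : HyperbolicRealization cs n) (Ω : Type*) (U : Type*) [Finite Ω]
      [AddCommGroup U] [Module ℂ U] (V : PermutationModule Γ Ω U),
      V.IsTransitive → V.IsTorsionFree → ∀ P ∈ V.correspondingSubgroups,
        T2Space (R.Quotient P) ∧ SecondCountableTopology (R.Quotient P) ∧
        (∃ c : ChartedSpace (EuclideanSpace ℝ (Fin n)) (R.Quotient P),
          R.IsQuotientSmoothStructure P c) ∧
        (∀ c : ChartedSpace (EuclideanSpace ℝ (Fin n)) (R.Quotient P),
          R.IsQuotientSmoothStructure P c →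
            (IsOrientableManifold n (R.Quotient P) ↔ V.IsOrientable cs)) ∧
        (V.IsOrientable cs ↔
          ∀ γ ∈ P, ∃ w : List B, Even w.length ∧ γ = cs.wordProd w)) := by
  refine ⟨fun Ω₁ Ω₂ U₁ U₂ _ _ _ _ _ _ V₁ V₂ hV₁ _ => PermutationModule.tensor_orientable cs V₁ V₂ hV₁,
    fun n R Ω U _ _ _ V ht htf P hP => ?_⟩
  have hfree := htf.eq_one_of_isOfFinOrder hP
  -- Once Π is the stabilizer of v, transitivity makes orientability of the module equivalent to
  -- evenness of Π, the common form of all three conditions.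
  obtain ⟨v, rfl⟩ := hP
  refine ⟨R.t2Space_quotient _, R.secondCountableTopology_quotient _,
    ⟨_, R.isQuotientSmoothStructure_quotientChartedSpace (R.isLocalHomeomorph_proj hfree)⟩,
    fun c hc => ?_, ?_⟩
  · rw [R.isOrientableManifold_iff hc, ht.isOrientable_iff_stabilizer_even cs v]
  · simp only [cs.exists_even_word_iff, ht.isOrientable_iff_stabilizer_even cs v]
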